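/- **Setting.** Let $d\ge 1$, let $\mathbb R^d$ carry Lebesgue measure and an arbitrary norm $\|\cdot\|$, with balls $B(x,\delta)=\{z:\|z-x\|<\delta\}$. Let $f,g$ be probability densities on $\mathbb R^d$, put $\mu=\frac{f+g}{2}$, $\Omega=\{\mu>0\}$ and $\eta=\frac{f}{f+g}$ on $\Omega$. Two independent i.i.d. samples of size $n$ are observed, $X_1,\dots,X_n$ with density $f$ (label $0$) and $\tilde X_1,\dots,\tilde X_n$ with density $g$ (label $1$). The risk of a measurable $\Phi:\mathbb R^d\to\{0,1\}$ is $$\mathcal R(\Phi)=\frac12\Big[\int_{\{\Phi=1\}}f\,dx+\int_{\{\Phi=0\}}g\,dx\Big],$$ and the Bayes classifier is $\Phi^*=\mathbf 1_{\{g\ge f\}}$. For $1\le k\le 2n$, $\Phi_{n,k}(x)=1$ if among the $k$ points of the aggregated sample of size $2n$ that are nearest to $x$ (ties broken by the index) the proportion of labels $1$ is $>\frac12$, and $\Phi_{n,k}(x)=0$ otherwise. **Assumptions.** Let $\alpha>0$. For positive constants $L,C,\kappa,\delta_0,\varepsilon_0$ and a function $\psi$, let $\mathcal F_\psi=\mathcal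 F_\psi(\alpha,L,C,\kappa,\delta_0,\varepsilon_0)$ be the set of all pairs $(f,g)$ such that * (smoothness) $|\eta(x_1)-\eta(x_2)|\le L\|x_1-x_2\|$ for all $x_1,x_2\in\Omega$; * (margin) $\int_{\{|\eta-1/2|<\varepsilon\}}(f+g)\,dx\le C\varepsilon^\alpha$ for all $\varepsilon>0$; * (minimal mass) $\int_{B(x,\delta)}\mu\,dz\ge\kappa\,\mu(x)\,\delta^d$ for all $x\in\Omega$ and $0<\delta\le\delta_0$; * (tail) $\int_{\{\mu<\varepsilon\}}\mu\,dx\le\psi(\varepsilon)$ for all $0<\varepsilon<\varepsilon_0$. **Theorem.** Let $c_1,c_2>0$. 1. ($\psi=\mathrm{Id}$.) There is a constant $A>0$ that depends only on the norm, $d$, $\alpha,L,C,\kappa,\delta_0,\varepsilon_0,c_1,c_2$ such that, for all $(f,g)\in\mathcal F_{\mathrm{Id}}$, all $n\ge2$, and all integers $k\le 2n$ with $c_1\nu_n^{-2}\le k\le c_2\nu_n^{-2}\log n$, where $\nu_n=\big(\frac{\log n}{n}\big)^{1/(3+\alpha+d)}$, the excess risk is integrable over the samples and $$\mathbb E\big[\mathcal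 R(\Phi_{n,k})\big]-\mathcal R(\Phi^*)\le A\Big(\frac{\log n}{n}\Big)^{\frac{1+\alpha}{3+\alpha+d}}.$$ 2. (General $\psi$.) Let $\psi:\mathbb R\to\mathbb R$ be strictly increasing on $(0,t_0)$ for some $t_0>0$, with $\psi(\varepsilon)\to0$ as $\varepsilon\downarrow0$, and put $\psi^{-1}(u)=\sup\{t\in(0,t_0):\psi(t)\le u\}$ for $u>0$ (the usual inverse for $u$ in the range $\psi((0,t_0))$). Then for every $n\ge2$ the equation $$\frac{\log n}{n}=\psi^{-1}\big(\nu_n^{1+\alpha}\big)\,\nu_n^{2+d}$$ has exactly one solution $\nu_n>0$. Moreover there is a constant $A>0$ that depends only on the norm, $d,\alpha,L,C,\kappa,\delta_0,\varepsilon_0,c_1,c_2,\psi,t_0$ such that, for all $(f,g)\in\mathcal F_\psi$, all $n\ge2$, and all integers $k\le 2n$ with $c_1\nu_n^{-2}\le k\le c_2\nu_n^{-2}\log n$, the excess risk is integrable over the samples and $$\mathbb E\big[\mathcal R(\Phi_{n,k})\big]-\mathcal R(\Phi^*)\le A\,\nu_n^{1+\alpha}.$$ -/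

import Mathlib

open MeasureTheory Filter Topology Set

noncomputable section

namespace SDA

variable {E : Type*} [NormedAddCommGroup E] [NormedSpace ℝ E] [MeasurableSpace E]

/-- `f` is a probability density with respect to `vol`. -/
structure IsDensity (vol : Measure E) (f : E → ℝ) : Prop where
  measurable : Measurable f
  nonneg : ∀ x, 0 ≤ f x
  integrable : Integrable f vol
  integral_eq_one : ∫ x, f x ∂vol = 1

/-- The law with density `f`. -/
def law (vol : Measure E) (f : E → ℝ) : Measure E :=
  vol.withDensity fun x => ENNReal.ofReal (f x)

/-- The density `μ = (f + g) / 2` of a new observation. -/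
def mu (f g : E → ℝ) (x : E) : ℝ := (f x + g x) / 2

/-- The regression function `η = f / (f + g)`, meaningful on the set `{f + g > 0}`. -/
def eta (f g : E → ℝ) (x : E) : ℝ := f x / (f x + g x)

/-- The set `Ω = {μ > 0}`, which carries the observations and where `η` is defined. -/
def Omega (f g : E → ℝ) : Set E := {x | 0 < mu f g x}

/-! ### The assumptions -/

/-- Smoothness: `η` is Lipschitz on `Ω` with constant `L`. -/
def Smoothness (f g : E → ℝ) (L : ℝ) : Prop :=
  ∀ x₁ ∈ Omega f g, ∀ x₂ ∈ Omega f g, |eta f g x₁ - eta f g x₂| ≤ L * ‖x₁ - x₂‖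

/-- Margin assumption with exponent `α` and constant `C`. -/
def Margin (vol : Measure E) (f g : E → ℝ) (α C : ℝ) : Prop :=
  ∀ ε > 0, ∫ x in {x | |eta f g x - 1 / 2| < ε}, (f x + g x) ∂vol ≤ C * ε ^ α

/-- Strong minimal mass assumption with constant `κ`, for all radii up to `δ₀`. -/
def MinimalMass (vol : Measure E) (f g : E → ℝ) (κ δ₀ : ℝ) : Prop :=
  ∀ δ > 0, δ ≤ δ₀ → ∀ x ∈ Omega f g,
    κ * mu f g x * δ ^ Module.finrank ℝ E ≤ ∫ z in Metric.ball x δ, mu f g z ∂vol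

/-- Tail assumption driven by `ψ`, for all levels below `ε₀`. -/
def Tail (vol : Measure E) (f g : E → ℝ) (ψ : ℝ → ℝ) (ε₀ : ℝ) : Prop :=
  ∀ ε > 0, ε < ε₀ → ∫ x in {x | mu f g x < ε}, mu f g x ∂vol ≤ ψ ε

/-- All the requirements on the pair of densities `(f, g)`, with their constants. -/
structure Admissible (vol : Measure E) (α L C κ δ₀ : ℝ) (ψ : ℝ → ℝ) (ε₀ : ℝ)
    (f g : E → ℝ) : Prop where
  density_f : IsDensity vol f
  density_g : IsDensity vol g
  smoothness : Smoothness f g L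
  margin : Margin vol f g α C
  minimalMass : MinimalMass vol f g κ δ₀
  tail : Tail vol f g ψ ε₀

/-! ### Risk and nearest neighbours -/

/-- The risk of a classifier: class `0` has density `f`, class `1` has density `g`. -/
def risk (vol : Measure E) (f g : E → ℝ) (Φ : E → Fin 2) : ℝ :=
  (1 / 2) * ((∫ x in {x | Φ x = 1}, f x ∂vol) + ∫ x in {x | Φ x = 0}, g x ∂vol)

open Classical in
/-- The Bayes classifier: it answers `1` exactly when the density `g` of class `1` is at least
the density `f` of class `0`. -/
def bayes (f g : E → ℝ) (x : E) : Fin 2 := if f x ≤ g x then 1 else 0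

/-- The two samples: `s.1` is the sample from `f` (label `0`), `s.2` the one from `g`
(label `1`). -/
abbrev Samples (E : Type*) (n : ℕ) : Type _ := (Fin n → E) × (Fin n → E)

/-- The law of two independent i.i.d. samples of size `n`, with densities `f` and `g`. -/
def samplesLaw (vol : Measure E) (f g : E → ℝ) (n : ℕ) : Measure (Samples E n) :=
  (Measure.pi fun _ : Fin n => law vol f).prod (Measure.pi fun _ : Fin n => law vol g)

/-- Positions of the aggregated sample of size `2n`. -/
def position {n : ℕ} (s : Samples E n) : Fin (n + n) → E := Fin.append s.1 s.2

/-- Labels of the aggregated sample. -/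
def label (n : ℕ) : Fin (n + n) → ℝ := Fin.append (fun _ => 0) (fun _ => 1)

/-- The permutation of the indices which orders the aggregated sample by increasing distance
to `x`: the `(j+1)`-st nearest neighbour of `x` has index `neighbour s x j`. Ties are broken by
the index. -/
def neighbour {n : ℕ} (s : Samples E n) (x : E) : Equiv.Perm (Fin (n + n)) :=
  Tuple.sort fun i => ‖position s i - x‖

/-- The proportion of labels `1` among the `k` nearest neighbours of `x` (for `k ≤ 2n`). -/
def etaHat {n : ℕ} (k : ℕ) (s : Samples E n) (x : E) : ℝ :=
  (1 / (k : ℝ)) * ∑ j : Fin (n + n), if (j : ℕ) < k then label n (neighbour s x j) else 0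

open Classical in
/-- The `k`-nearest neighbour classifier. -/
def knn {n : ℕ} (k : ℕ) (s : Samples E n) (x : E) : Fin 2 :=
  if 1 / 2 < etaHat k s x then 1 else 0

/-- The excess risk of the `k`-nearest neighbour classifier trained on the samples `s`. -/
def excessRisk (vol : Measure E) (f g : E → ℝ) {n : ℕ} (k : ℕ) (s : Samples E n) : ℝ :=
  risk vol f g (knn k s) - risk vol f g (bayes f g)

/-- The excess risk is integrable and its expectation over the samples is at most `b`. -/
def ExpectedExcessRiskLE (vol : Measure E) (f g : E → ℝ) (n k : ℕ) (b : ℝ) : Prop :=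
  Integrable (fun s : Samples E n => excessRisk vol f g k s) (samplesLaw vol f g n) ∧
    ∫ s, excessRisk vol f g k s ∂(samplesLaw vol f g n) ≤ b

/-! ### Numbers of neighbours and rates -/

/-- `k` is an admissible number of neighbours for the sample size `n` and the target accuracy
`ν`: up to the constants `c₁`, `c₂`, it lies between `ν⁻²` and `ν⁻² log n`. -/
def NumNeighbours (c₁ c₂ : ℝ) (n : ℕ) (ν : ℝ) (k : ℕ) : Prop :=
  k ≤ 2 * n ∧ c₁ ≤ k * ν ^ 2 ∧ k * ν ^ 2 ≤ c₂ * Real.log n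

/-- The inverse of `ψ` on the interval `(0, t₀)` where it is increasing:
`u ↦ sup {t ∈ (0, t₀) | ψ t ≤ u}`. -/
def inverse (ψ : ℝ → ℝ) (t₀ u : ℝ) : ℝ := sSup {t | t ∈ Ioo 0 t₀ ∧ ψ t ≤ u}

/-- On the range of `ψ` it is indeed the inverse function, whatever `t₀`. -/
theorem inverse_apply {ψ : ℝ → ℝ} {t₀ a : ℝ} (hψ : StrictMonoOn ψ (Ioo 0 t₀))
    (ha : a ∈ Ioo 0 t₀) : inverse ψ t₀ (ψ a) = a := by
  refine IsGreatest.csSup_eq ⟨⟨ha, le_rfl⟩, ?_⟩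
  rintro t ⟨ht, h⟩
  exact (hψ.le_iff_le ht ha).1 h

/-- The balance equation `log n / n = ψ⁻¹(ν^{1+α}) ν^{2+d}` for `ν > 0`. -/
def Balance (ψ : ℝ → ℝ) (t₀ α : ℝ) (d n : ℕ) (ν : ℝ) : Prop :=
  0 < ν ∧ Real.log n / n = inverse ψ t₀ (ν ^ (1 + α)) * ν ^ (2 + d)

end SDA

end

noncomputable section

namespace SDA

section

/-! ### The nearest neighbours lie in a ball which contains many points -/

/-! The excess risk is the integral of `2 * D * mu` times the probability that the rule disagrees
with Bayes at `x`, where `D = |η(x) - 1/2|` (`risk_sub_risk_bayes`, then Fubini in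
`expectedExcessRiskLE_of_integral_le`). It therefore suffices to bound this probability at each
fixed `x`; no uniformity over `x` is needed.

At a fixed `x`, the random ball of the nearest neighbours is replaced by a deterministic one. If a
ball contains at least `k` sample points, it contains all the neighbours, so an error forces at
least `k/2` wrongly labelled points into it. Choose its radius so that the expected number of points
is exactly `k * (1 + D/2)`. When this radius is at most `D/(2L)`, smoothness keeps `η` on the
correct side of `1/2` by `D/2`, and the expected number of wrong labels is at most `k/2 * (1 -
D/2)`. Two Chernoff bounds then give an error probability at most `2 * exp(-k * D^2 / 32)`
(`measure_knn_ne_bayes_le`).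

For the integral (`integral_error_le`), the space is cut into the region of low density, controlled
by the tail assumption; the strip where `D` is below a multiple of `ν`, controlled by the margin;
and the rest, where `k ≥ c₁ / ν^2` makes the bound Gaussian in `D/ν` and a peeling over multiples of
`ν` sums to `O(ν^(1+α))`. The balance equation is what puts enough mass in the balls of radius of
order `ν` around points of non-negligible density, given `k ≤ c₂ * log n / ν^2`. -/

/-- If the value of rank `j` were at least `ρ`, every index with value below `ρ` would have rank
below `j`, leaving at most `j < k` of them. -/
theorem sort_lt_of_card {m k : ℕ} (D : Fin m → ℝ) (ρ : ℝ)
    (hk : k ≤ (Finset.univ.filter fun i => D i < ρ).card) (j : Fin m) (hj : (j : ℕ) < k) :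
    D (Tuple.sort D j) < ρ := by
  by_contra! h
  have hsub : (Finset.univ.filter fun i => D i < ρ) ⊆
      (Finset.univ.filter fun l : Fin m => l < j).image (Tuple.sort D) := by
    intro i hi
    simp only [Finset.mem_filter, Finset.mem_univ, true_and, Finset.mem_image] at hi ⊢
    refine ⟨(Tuple.sort D).symm i, ?_, Equiv.apply_symm_apply _ _⟩
    by_contra! hij
    have := Tuple.monotone_sort D hij
    simp only [Function.comp, Equiv.apply_symm_apply] at this
    linarith
  have h1 := (Finset.card_le_card hsub).trans Finset.card_image_le
  have h2 : (Finset.univ.filter fun l : Fin m => l < j).card = j := by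
    rw [Finset.filter_gt_eq_Iio, Fin.card_Iio]
  omega

theorem sum_sort_le {m k : ℕ} (D : Fin m → ℝ) (ρ : ℝ)
    (hk : k ≤ (Finset.univ.filter fun i => D i < ρ).card) (w : Fin m → ℝ) (hw : ∀ i, 0 ≤ w i) :
    (∑ j : Fin m, if (j : ℕ) < k then w (Tuple.sort D j) else 0) ≤
      ∑ i, if D i < ρ then w i else 0 := by
  rw [← Equiv.sum_comp (Tuple.sort D) fun i => if D i < ρ then w i else 0]
  refine Finset.sum_le_sum fun j _ => ?_
  by_cases hj : (j : ℕ) < k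
  · rw [if_pos hj, if_pos (sort_lt_of_card D ρ hk j hj)]
  · rw [if_neg hj]
    split_ifs
    exacts [hw _, le_rfl]

variable {E : Type*} [NormedAddCommGroup E]

/-- The number of points of a sample which lie in the set `A`. -/
def count {n : ℕ} (A : Set E) (s : Fin n → E) : ℝ := ∑ i, A.indicator 1 (s i)

theorem label_castAdd {n : ℕ} (i : Fin n) : label n (Fin.castAdd n i) = 0 := by simp [label]

theorem label_natAdd {n : ℕ} (i : Fin n) : label n (Fin.natAdd n i) = 1 := by
  rw [label, Fin.append_right]

theorem label_mem {n : ℕ} (i : Fin (n + n)) : 0 ≤ label n i ∧ label n i ≤ 1 := by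
  refine Fin.addCases (fun j => ?_) (fun j => ?_) i
  · simp [label_castAdd]
  · rw [label_natAdd]
    norm_num

theorem sum_ite_ball {n : ℕ} (s : Samples E n) (x : E) (ρ : ℝ) (w : Fin (n + n) → ℝ) (a b : ℝ)
    (ha : ∀ i, w (Fin.castAdd n i) = a) (hb : ∀ i, w (Fin.natAdd n i) = b) :
    (∑ i, if ‖position s i - x‖ < ρ then w i else 0) =
      a * count (Metric.ball x ρ) s.1 + b * count (Metric.ball x ρ) s.2 := by
  classical
  rw [Fin.sum_univ_add]
  simp only [position, Fin.append_left, Fin.append_right, ha, hb, count, Finset.mul_sum,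
    Set.indicator_apply, mem_ball_iff_norm, Pi.one_apply, mul_ite, mul_one, mul_zero]

theorem le_card_ball {n k : ℕ} (s : Samples E n) (x : E) (ρ : ℝ)
    (h : (k : ℝ) ≤ count (Metric.ball x ρ) s.1 + count (Metric.ball x ρ) s.2) :
    k ≤ (Finset.univ.filter fun i => ‖position s i - x‖ < ρ).card := by
  have h1 := sum_ite_ball s x ρ (fun _ => 1) 1 1 (fun _ => rfl) fun _ => rfl
  simp only [Finset.sum_boole, one_mul] at h1
  exact_mod_cast h1 ▸ h

/-- A ball with at least `k` points, to which the `k`-nearest neighbour rule gives the label `1`,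
contains at least `k / 2` points with label `1`. -/
theorem half_le_count_of_knn_eq_one {n k : ℕ} (hk : 0 < k) (s : Samples E n) (x : E) (ρ : ℝ)
    (h : (k : ℝ) ≤ count (Metric.ball x ρ) s.1 + count (Metric.ball x ρ) s.2)
    (h1 : knn k s x = 1) : (k : ℝ) / 2 ≤ count (Metric.ball x ρ) s.2 := by
  have h2 := sum_sort_le _ ρ (le_card_ball s x ρ h) (label n) fun i => (label_mem i).1
  rw [sum_ite_ball s x ρ _ 0 1 label_castAdd label_natAdd] at h2
  have h3 : 1 / 2 < etaHat k s x := by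
    by_contra h3
    rw [knn, if_neg h3] at h1
    exact zero_ne_one h1
  have hk' : (0 : ℝ) < k := by exact_mod_cast hk
  rw [etaHat, one_div_mul_eq_div, lt_div_iff₀ hk'] at h3
  simp only [neighbour] at h3
  linarith

/-- A ball with at least `k` points, to which the `k`-nearest neighbour rule gives the label `0`,
contains at least `k / 2` points with label `0`. -/
theorem half_le_count_of_knn_eq_zero {n k : ℕ} (hk : 0 < k) (hkn : k ≤ 2 * n) (s : Samples E n)
    (x : E) (ρ : ℝ)
    (h : (k : ℝ) ≤ count (Metric.ball x ρ) s.1 + count (Metric.ball x ρ) s.2)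
    (h1 : knn k s x = 0) : (k : ℝ) / 2 ≤ count (Metric.ball x ρ) s.1 := by
  have h2 := sum_sort_le _ ρ (le_card_ball s x ρ h) (fun i => 1 - label n i)
    fun i => sub_nonneg.2 (label_mem i).2
  rw [sum_ite_ball s x ρ _ 1 0 (by simp [label_castAdd]) fun i => by
    rw [label_natAdd, sub_self]] at h2
  have h3 : etaHat k s x ≤ 1 / 2 := by
    by_contra! h3
    rw [knn, if_pos h3] at h1
    exact one_ne_zero h1
  have hk' : (0 : ℝ) < k := by exact_mod_cast hk
  rw [etaHat, one_div_mul_eq_div, div_le_iff₀ hk'] at h3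
  have h4 : (∑ j : Fin (n + n), if (j : ℕ) < k then
      1 - label n (Tuple.sort (fun i => ‖position s i - x‖) j) else 0) =
      k - ∑ j : Fin (n + n), if (j : ℕ) < k then label n (neighbour s x j) else 0 := by
    -- This is where `k ≤ 2 * n` matters: there really are `k` neighbours.
    have h5 : (∑ j : Fin (n + n), if (j : ℕ) < k then (1 : ℝ) else 0) = k := by
      rw [Finset.sum_boole, Fin.card_filter_val_lt]
      norm_cast
      omega
    rw [← h5, ← Finset.sum_sub_distrib]
    refine Finset.sum_congr rfl fun j _ => ?_
    split_ifs <;> simp [neighbour]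
  linarith

/-! ### Measurability of the nearest neighbour rule -/

/-- The sorting permutation is characterised by finitely many comparisons between coordinates,
tie-breaking included. The rule depends on the data only through this permutation, which takes
finitely many values. -/
theorem measurable_sort {Ω : Type*} [MeasurableSpace Ω] {m : ℕ} {D : Ω → Fin m → ℝ}
    (hD : ∀ i, Measurable fun ω => D ω i) (σ : Equiv.Perm (Fin m)) :
    MeasurableSet {ω | Tuple.sort (D ω) = σ} := by
  have : {ω | Tuple.sort (D ω) = σ} = ⋂ i : Fin m, ⋂ j : Fin m,
      {ω | (i ≤ j → D ω (σ i) ≤ D ω (σ j)) ∧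
        (i < j → D ω (σ i) = D ω (σ j) → σ i < σ j)} := by
    ext ω
    rw [mem_ofPred_eq, eq_comm, Tuple.eq_sort_iff]
    simp only [mem_iInter, mem_ofPred_eq]
    exact ⟨fun h i j => ⟨fun hij => h.1 hij, h.2 i j⟩,
      fun h => ⟨fun i j hij => (h i j).1 hij, fun i j => (h i j).2⟩⟩
  rw [this]
  refine .iInter fun i => .iInter fun j => ?_
  refine MeasurableSet.inter ?_ ?_
  · exact (MeasurableSet.const _).imp (measurableSet_le (hD _) (hD _))
  · exact (MeasurableSet.const _).imp
      ((measurableSet_eq_fun (hD _) (hD _)).imp (MeasurableSet.const _))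

theorem measurable_knn [NormedSpace ℝ E] [MeasurableSpace E] [FiniteDimensional ℝ E]
    [BorelSpace E] (n k : ℕ) :
    Measurable fun p : Samples E n × E => knn k p.1 p.2 := by
  have : SecondCountableTopology E :=
    have := FiniteDimensional.proper ℝ E
    inferInstance
  have hpos : ∀ i : Fin (n + n), Measurable fun p : Samples E n × E => position p.1 i := by
    refine Fin.addCases (fun i => ?_) (fun i => ?_)
    · simp only [position, Fin.append_left]
      fun_prop
    · simp only [position, Fin.append_right]
      fun_prop
  let b : Equiv.Perm (Fin (n + n)) → Fin 2 := fun σ => open Classical in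
    if 1 / 2 < (1 / (k : ℝ)) * ∑ j : Fin (n + n), if (j : ℕ) < k then label n (σ j) else 0
    then 1 else 0
  have hb : (fun p : Samples E n × E => knn k p.1 p.2) = fun p => b (neighbour p.1 p.2) := rfl
  rw [hb]
  refine measurable_to_countable' fun c => ?_
  have : (fun p : Samples E n × E => b (neighbour p.1 p.2)) ⁻¹' {c} =
      ⋃ σ ∈ {σ | b σ = c}, {p | neighbour p.1 p.2 = σ} := by
    ext p
    simp
  rw [this]
  refine .biUnion (Set.to_countable _) fun σ _ => ?_
  exact measurable_sort (D := fun p : Samples E n × E => fun i => ‖position p.1 i - p.2‖)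
    (fun i => ((hpos i).sub measurable_snd).norm) σ

end

section

/-! ### Chernoff bounds for the number of points in a set -/

section Chernoff

variable {E : Type*} {n : ℕ} {A : Set E}

theorem count_nonneg (A : Set E) (s : Fin n → E) : 0 ≤ count A s :=
  Finset.sum_nonneg fun _ _ => indicator_nonneg (fun _ _ => zero_le_one) _

theorem count_le (A : Set E) (s : Fin n → E) : count A s ≤ n := by
  refine (Finset.sum_le_sum fun i _ => indicator_le_self' (fun _ _ => zero_le_one) (s i)).trans ?_
  simp

variable [MeasurableSpace E]

theorem measurable_count (hA : MeasurableSet A) : Measurable fun s : Fin n → E => count A s := by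
  refine Finset.measurable_fun_sum _ fun i _ => ?_
  exact ((measurable_const (a := (1 : ℝ))).indicator hA).comp (measurable_pi_apply i)

/-- By independence the left side is `(1 + p * (exp t - 1))^n` with `p = P(A)`, and `1 + x ≤ exp x`
bounds it by a Poisson moment generating function. -/
theorem integral_exp_mul_count_le (P : Measure E) [IsProbabilityMeasure P] (hA : MeasurableSet A)
    (t : ℝ) :
    ∫ s, Real.exp (t * count A s) ∂(Measure.pi fun _ : Fin n => P) ≤
      Real.exp (n * P.real A * (Real.exp t - 1)) := by
  have h1 : ∀ y : E, Real.exp (t * A.indicator 1 y) =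
      1 + A.indicator (fun _ => Real.exp t - 1) y := by
    intro y
    by_cases hy : y ∈ A <;> simp [hy]
  have h2 : ∫ s, Real.exp (t * count A s) ∂(Measure.pi fun _ : Fin n => P) =
      (∫ y, Real.exp (t * A.indicator 1 y) ∂P) ^ n := by
    simp only [count, Finset.mul_sum, Real.exp_sum]
    rw [integral_fintype_prod_eq_pow (𝕜 := ℝ) (ι := Fin n) fun y => Real.exp (t * A.indicator 1 y),
      Fintype.card_fin]
  have h3 : ∫ y, Real.exp (t * A.indicator 1 y) ∂P = 1 + P.real A * (Real.exp t - 1) := by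
    simp only [h1]
    rw [integral_add (integrable_const _) ((integrable_const _).indicator hA),
      integral_indicator_const _ hA]
    simp
  rw [h2, mul_assoc, Real.exp_nat_mul]
  refine pow_le_pow_left₀ (integral_nonneg fun _ => (Real.exp_pos _).le) ?_ n
  rw [h3, add_comm]
  exact Real.add_one_le_exp _

theorem integrable_exp_mul_count (P : Measure E) [IsProbabilityMeasure P] (hA : MeasurableSet A)
    (t : ℝ) :
    Integrable (fun s => Real.exp (t * count A s)) (Measure.pi fun _ : Fin n => P) := by
  refine Integrable.of_bound (C := Real.exp (|t| * n))
    (((measurable_count hA).const_mul t).exp.aestronglyMeasurable) (ae_of_all _ fun s => ?_)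
  rw [Real.norm_of_nonneg (Real.exp_pos _).le, Real.exp_le_exp]
  exact mul_le_mul (le_abs_self t) (count_le A s) (count_nonneg A s) (abs_nonneg t)

theorem exp_le_one_add_add_sq {t : ℝ} (h : |t| ≤ 1) : Real.exp t ≤ 1 + t + t ^ 2 := by
  have := Real.abs_exp_sub_one_sub_id_le h
  linarith [le_abs_self (Real.exp t - 1 - t)]

/-- Upper tail bound for the number of points of a sample in a set. -/
theorem measure_half_le_count (P : Measure E) [IsProbabilityMeasure P] (hA : MeasurableSet A)
    {k : ℕ} {δ : ℝ} (hδ : 0 ≤ δ) (hδ1 : δ ≤ 1) (hm : n * P.real A ≤ k / 2 * (1 - δ)) :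
    (Measure.pi fun _ : Fin n => P).real {s | (k : ℝ) / 2 ≤ count A s} ≤
      Real.exp (-(k * δ ^ 2 / 8)) := by
  -- The choice `t = δ/2` is nearly optimal: with `exp t - 1 ≤ t + t^2` the exponent becomes `-k *
  -- (δ^2 + δ^3) / 8`.
  have h := ProbabilityTheory.measure_ge_le_exp_mul_mgf (μ := Measure.pi fun _ : Fin n => P)
    (X := fun s => count A s) ((k : ℝ) / 2) (t := δ / 2) (by positivity)
    (integrable_exp_mul_count P hA _)
  refine h.trans ?_
  refine (mul_le_mul_of_nonneg_left (integral_exp_mul_count_le P hA _)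
    (Real.exp_pos _).le).trans ?_
  rw [← Real.exp_add, Real.exp_le_exp]
  have h1 : Real.exp (δ / 2) - 1 ≤ δ / 2 + (δ / 2) ^ 2 := by
    linarith [exp_le_one_add_add_sq (t := δ / 2) (by rw [abs_le]; constructor <;> linarith)]
  have h2 : n * P.real A * (Real.exp (δ / 2) - 1) ≤
      k / 2 * (1 - δ) * (δ / 2 + (δ / 2) ^ 2) := by
    refine mul_le_mul hm h1 ?_ (mul_nonneg (by positivity) (by linarith))
    linarith [Real.add_one_le_exp (δ / 2)]
  have h3 : (0 : ℝ) ≤ k * δ ^ 3 := by positivity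
  nlinarith

/-- Lower tail bound for the number of points of the aggregated sample in a set. -/
theorem measure_count_add_count_lt (P Q : Measure E) [IsProbabilityMeasure P]
    [IsProbabilityMeasure Q] (hA : MeasurableSet A) {k : ℕ} {δ : ℝ} (hδ : 0 ≤ δ) (hδ1 : δ ≤ 1 / 2)
    (hm : (k : ℝ) * (1 + δ) ≤ n * P.real A + n * Q.real A) :
    ((Measure.pi fun _ : Fin n => P).prod (Measure.pi fun _ : Fin n => Q)).real
      {s : Samples E n | count A s.1 + count A s.2 < k} ≤ Real.exp (-(k * δ ^ 2 / 8)) := by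
  set μ := (Measure.pi fun _ : Fin n => P).prod (Measure.pi fun _ : Fin n => Q)
  have hexp : ∀ s : Samples E n, Real.exp (-(δ / 2) * (count A s.1 + count A s.2)) =
      Real.exp (-(δ / 2) * count A s.1) * Real.exp (-(δ / 2) * count A s.2) := fun s => by
    rw [mul_add, Real.exp_add]
  have hint : Integrable (fun s : Samples E n =>
      Real.exp (-(δ / 2) * (count A s.1 + count A s.2))) μ := by
    simp only [hexp]
    exact (integrable_exp_mul_count P hA _).mul_prod (integrable_exp_mul_count Q hA _)
  have h := ProbabilityTheory.measure_le_le_exp_mul_mgf (μ := μ)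
    (X := fun s => count A s.1 + count A s.2) (k : ℝ) (t := -(δ / 2)) (by linarith) hint
  have hsub : {s : Samples E n | count A s.1 + count A s.2 < k} ⊆
      {s | count A s.1 + count A s.2 ≤ k} := fun s hs => by
    rw [mem_ofPred_eq] at hs ⊢
    exact hs.le
  refine (measureReal_mono hsub).trans (h.trans ?_)
  have hmgf : ProbabilityTheory.mgf (fun s : Samples E n => count A s.1 + count A s.2) μ
      (-(δ / 2)) ≤ Real.exp (n * P.real A * (Real.exp (-(δ / 2)) - 1)) *
        Real.exp (n * Q.real A * (Real.exp (-(δ / 2)) - 1)) := by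
    simp only [ProbabilityTheory.mgf, hexp]
    rw [integral_prod_mul (fun s : Fin n → E => Real.exp (-(δ / 2) * count A s))
      fun s : Fin n → E => Real.exp (-(δ / 2) * count A s)]
    exact mul_le_mul (integral_exp_mul_count_le P hA _) (integral_exp_mul_count_le Q hA _)
      (integral_nonneg fun _ => (Real.exp_pos _).le) (Real.exp_pos _).le
  refine (mul_le_mul_of_nonneg_left hmgf (Real.exp_pos _).le).trans ?_
  rw [← Real.exp_add, ← Real.exp_add, Real.exp_le_exp]
  have h1 : Real.exp (-(δ / 2)) - 1 ≤ -(δ / 2) + (δ / 2) ^ 2 := by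
    have := exp_le_one_add_add_sq (t := -(δ / 2)) (by rw [abs_le]; constructor <;> linarith)
    rw [neg_sq] at this
    linarith
  have h2 : (n * P.real A + n * Q.real A) * (Real.exp (-(δ / 2)) - 1) ≤
      k * (1 + δ) * (-(δ / 2) + (δ / 2) ^ 2) := by
    refine (mul_le_mul_of_nonneg_left h1 (by positivity)).trans
      (mul_le_mul_of_nonpos_right hm ?_)
    nlinarith
  -- The exponent is now `-k * (δ^2 - δ^3) / 4`, which is at most `-k * δ^2 / 8` precisely because
  -- `δ ≤ 1/2`.
  have h3 : (0 : ℝ) ≤ k * δ ^ 2 * (1 / 2 - δ) := mul_nonneg (by positivity) (by linarith)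
  nlinarith

end Chernoff

end

section

/-! ### The probability of a wrong answer at a given point -/

theorem add_eq_two_mul_mu {E : Type*} (f g : E → ℝ) (x : E) : f x + g x = 2 * mu f g x := by
  rw [mu]
  ring

theorem eta_mul_add {E : Type*} {f g : E → ℝ} {x : E} (hx : x ∈ Omega f g) :
    eta f g x * (f x + g x) = f x := by
  have h : 0 < mu f g x := hx
  have := add_eq_two_mul_mu f g x
  exact div_mul_cancel₀ _ (by linarith)

section Densities

variable {E : Type*} [MeasurableSpace E] {vol : Measure E} {f g : E → ℝ}

theorem IsDensity.isProbabilityMeasure_law (hf : IsDensity vol f) :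
    IsProbabilityMeasure (law vol f) := by
  refine ⟨?_⟩
  rw [law, withDensity_apply _ MeasurableSet.univ, Measure.restrict_univ,
    ← ofReal_integral_eq_lintegral_ofReal hf.integrable (ae_of_all _ hf.nonneg),
    hf.integral_eq_one, ENNReal.ofReal_one]

theorem IsDensity.law_real (hf : IsDensity vol f) {A : Set E} (hA : MeasurableSet A) :
    (law vol f).real A = ∫ x in A, f x ∂vol := by
  rw [Measure.real, law, withDensity_apply _ hA,
    ← ofReal_integral_eq_lintegral_ofReal hf.integrable.restrict (ae_of_all _ hf.nonneg),
    ENNReal.toReal_ofReal (integral_nonneg hf.nonneg)]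

theorem mu_nonneg (hf : IsDensity vol f) (hg : IsDensity vol g) (x : E) : 0 ≤ mu f g x :=
  div_nonneg (add_nonneg (hf.nonneg x) (hg.nonneg x)) zero_le_two

theorem measurable_mu (hf : IsDensity vol f) (hg : IsDensity vol g) : Measurable (mu f g) :=
  (hf.measurable.add hg.measurable).div_const 2

theorem measurable_eta (hf : IsDensity vol f) (hg : IsDensity vol g) : Measurable (eta f g) :=
  hf.measurable.div (hf.measurable.add hg.measurable)

theorem integrable_mu (hf : IsDensity vol f) (hg : IsDensity vol g) : Integrable (mu f g) vol :=
  (hf.integrable.add hg.integrable).div_const 2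

theorem integral_mu (hf : IsDensity vol f) (hg : IsDensity vol g) : ∫ x, mu f g x ∂vol = 1 := by
  simp only [mu]
  rw [integral_div, integral_add hf.integrable hg.integrable, hf.integral_eq_one,
    hg.integral_eq_one]
  norm_num

theorem eq_zero_of_notMem_Omega (hf : IsDensity vol f) (hg : IsDensity vol g) {x : E}
    (hx : x ∉ Omega f g) : f x = 0 ∧ g x = 0 := by
  have h : mu f g x ≤ 0 := not_lt.1 hx
  have := add_eq_two_mul_mu f g x
  constructor <;> linarith [hf.nonneg x, hg.nonneg x]

theorem abs_sub_div_two (hf : IsDensity vol f) (hg : IsDensity vol g) (x : E) :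
    |f x - g x| / 2 = 2 * |eta f g x - 1 / 2| * mu f g x := by
  by_cases hx : x ∈ Omega f g
  · have h1 := eta_mul_add hx
    have h2 : f x - g x = (2 * (eta f g x - 1 / 2)) * (f x + g x) := by linarith
    rw [h2, abs_mul, abs_mul, abs_of_nonneg (add_nonneg (hf.nonneg x) (hg.nonneg x)),
      add_eq_two_mul_mu, abs_two]
    ring
  · obtain ⟨h1, h2⟩ := eq_zero_of_notMem_Omega hf hg hx
    simp [mu, h1, h2]

/-- The bound needs no restriction to `Omega`: elsewhere division by zero makes `eta` equal to `0`.
-/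
theorem abs_eta_sub_half_le (hf : IsDensity vol f) (hg : IsDensity vol g) (x : E) :
    |eta f g x - 1 / 2| ≤ 1 / 2 := by
  have h0 : 0 ≤ eta f g x := div_nonneg (hf.nonneg x) (add_nonneg (hf.nonneg x) (hg.nonneg x))
  have h1 : eta f g x ≤ 1 :=
    div_le_one_of_le₀ (by linarith [hg.nonneg x]) (add_nonneg (hf.nonneg x) (hg.nonneg x))
  rw [abs_le]
  constructor <;> linarith

theorem isProbabilityMeasure_samplesLaw (hf : IsDensity vol f) (hg : IsDensity vol g) (n : ℕ) :
    IsProbabilityMeasure (samplesLaw vol f g n) := by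
  have := hf.isProbabilityMeasure_law
  have := hg.isProbabilityMeasure_law
  rw [samplesLaw]
  infer_instance

end Densities

variable {E : Type*} [NormedAddCommGroup E] [NormedSpace ℝ E] [FiniteDimensional ℝ E]
  [MeasurableSpace E] [BorelSpace E] {vol : Measure E} [vol.IsAddHaarMeasure] {f g : E → ℝ}

/-- Spheres are null for Haar measure in nonzero dimension, so the indicators of the balls vary
continuously almost everywhere and dominated convergence applies. -/
theorem continuous_integral_ball [Nontrivial E] {h : E → ℝ} (hh : Integrable h vol) (x : E) :
    Continuous fun r => ∫ z in Metric.ball x r, h z ∂vol := by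
  rw [continuous_iff_continuousAt]
  intro r
  simp only [← integral_indicator (Metric.isOpen_ball.measurableSet)]
  refine continuousAt_of_dominated (bound := fun z => ‖h z‖)
    (Eventually.of_forall fun r => (hh.indicator Metric.isOpen_ball.measurableSet).1)
    (Eventually.of_forall fun r => ae_of_all _ fun z => norm_indicator_le_norm_self _ _)
    hh.norm ?_
  have : ∀ᵐ z ∂vol, z ∉ Metric.sphere x r :=
    measure_eq_zero_iff_ae_notMem.1 (Measure.addHaar_sphere vol x r)
  filter_upwards [this] with z hz
  rcases lt_or_gt_of_ne (show dist z x ≠ r from hz) with h1 | h1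
  · refine (continuousAt_const (y := h z)).congr ?_
    filter_upwards [lt_mem_nhds h1] with s hs
    exact (indicator_of_mem (Metric.mem_ball.2 hs) h).symm
  · refine (continuousAt_const (y := (0 : ℝ))).congr ?_
    filter_upwards [gt_mem_nhds h1] with s hs
    exact (indicator_of_notMem (fun hm => (Metric.mem_ball.1 hm).not_gt hs) h).symm

theorem exists_integral_ball_eq [Nontrivial E] {h : E → ℝ} (hh : Integrable h vol) (x : E)
    {r c : ℝ} (hr : 0 ≤ r) (hc : 0 ≤ c) (hcr : c ≤ ∫ z in Metric.ball x r, h z ∂vol) :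
    ∃ ρ ≤ r, ∫ z in Metric.ball x ρ, h z ∂vol = c := by
  obtain ⟨ρ, hρ, h⟩ := intermediate_value_Icc hr (continuous_integral_ball hh x).continuousOn
    (show c ∈ Icc _ _ from ⟨by simpa using hc, hcr⟩)
  exact ⟨ρ, hρ.2, h⟩

/-- At a point `x` where `η` is at distance at least `2 L r` from `1 / 2`, and such that the ball
with radius `r` contains enough mass, the `k`-nearest neighbour rule differs from the Bayes
classifier with exponentially small probability. -/
theorem measure_knn_ne_bayes_le [Nontrivial E] (hf : IsDensity vol f) (hg : IsDensity vol g)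
    {L : ℝ} (hL : 0 ≤ L) (hs : Smoothness f g L) {n k : ℕ} (hk : 0 < k) (hkn : k ≤ 2 * n) {x : E}
    (hx : x ∈ Omega f g) {r : ℝ} (hr : 0 ≤ r) (hLr : 2 * L * r ≤ |eta f g x - 1 / 2|)
    (hmass : (k : ℝ) * (1 + |eta f g x - 1 / 2| / 2) ≤
      2 * n * ∫ z in Metric.ball x r, mu f g z ∂vol) :
    (samplesLaw vol f g n).real {s | knn k s x ≠ bayes f g x} ≤
      2 * Real.exp (-(k * |eta f g x - 1 / 2| ^ 2 / 32)) := by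
  have := hf.isProbabilityMeasure_law
  have := hg.isProbabilityMeasure_law
  have hD1 := abs_eta_sub_half_le hf hg x
  set D := |eta f g x - 1 / 2| with hD
  have hD0 : 0 ≤ D := abs_nonneg _
  have hn : (0 : ℝ) < n := by
    have : 0 < n := by omega
    exact_mod_cast this
  have hk0 : (0 : ℝ) < k := by exact_mod_cast hk
  -- An exact mass is needed because it must be bounded below, to catch `k` points, and above, to
  -- limit the wrong labels.
  obtain ⟨ρ, hρr, hρ⟩ := exists_integral_ball_eq (integrable_mu hf hg) x
    (c := k * (1 + D / 2) / (2 * n)) hr (by positivity)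
    ((div_le_iff₀' (by positivity)).2 hmass)
  set B := Metric.ball x ρ
  have hBm : MeasurableSet B := Metric.isOpen_ball.measurableSet
  have hadd : (∫ z in B, f z ∂vol) + ∫ z in B, g z ∂vol = k * (1 + D / 2) / n := by
    rw [← integral_add hf.integrable.restrict hg.integrable.restrict]
    simp only [add_eq_two_mul_mu]
    rw [integral_const_mul, hρ]
    field_simp
  have hsum : (n : ℝ) * (law vol f).real B + n * (law vol g).real B = k * (1 + D / 2) := by
    rw [hf.law_real hBm, hg.law_real hBm, ← mul_add, hadd]
    field_simp
  have hlow : (samplesLaw vol f g n).real {s | count B s.1 + count B s.2 < k} ≤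
      Real.exp (-(k * D ^ 2 / 32)) := by
    refine (measure_count_add_count_lt (law vol f) (law vol g) hBm (k := k) (δ := D / 2)
      (by positivity) (by linarith) hsum.ge).trans_eq ?_
    congr 1
    ring
  have hball : ∀ z ∈ B, z ∈ Omega f g → |eta f g z - eta f g x| ≤ D / 2 := by
    intro z hz hzO
    refine (hs z hzO x hx).trans ?_
    have h1 : ‖z - x‖ ≤ r := (mem_ball_iff_norm.1 hz).le.trans hρr
    nlinarith
  -- a density which is at most `(1 - D) / 2` times `f + g` on the ball gives few points there
  have key : ∀ h : E → ℝ, IsDensity vol h →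
      (∀ z ∈ B, z ∈ Omega f g → h z ≤ (1 - D) / 2 * (f z + g z)) →
      (∀ z, z ∉ Omega f g → h z = 0) →
      (Measure.pi fun _ : Fin n => law vol h).real {s | (k : ℝ) / 2 ≤ count B s} ≤
        Real.exp (-(k * D ^ 2 / 32)) := by
    intro h hh h1 h2
    have := hh.isProbabilityMeasure_law
    have h3 : ∫ z in B, h z ∂vol ≤ (1 - D) / 2 * (k * (1 + D / 2) / n) := by
      rw [← hadd, ← integral_add hf.integrable.restrict hg.integrable.restrict,
        ← integral_const_mul]
      refine setIntegral_mono_on hh.integrable.integrableOn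
        ((hf.integrable.add hg.integrable).const_mul _).integrableOn hBm fun z hz => ?_
      by_cases hzO : z ∈ Omega f g
      · exact h1 z hz hzO
      · rw [h2 z hzO]
        exact mul_nonneg (by linarith) (add_nonneg (hf.nonneg z) (hg.nonneg z))
    refine (measure_half_le_count (law vol h) hBm (k := k) (δ := D / 2)
      (by positivity) (by linarith) ?_).trans_eq ?_
    · rw [hh.law_real hBm]
      have h4 := mul_le_mul_of_nonneg_left h3 hn.le
      have h5 : (n : ℝ) * ((1 - D) / 2 * (k * (1 + D / 2) / n)) =
          k / 2 * ((1 - D) * (1 + D / 2)) := by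
        field_simp
      rw [h5] at h4
      refine h4.trans (mul_le_mul_of_nonneg_left ?_ (by positivity))
      -- `(1 - D) * (1 + D/2) = 1 - D/2 - D^2/2`, so the relative gap `δ = D/2` remains.
      nlinarith
    · congr 1
      ring
  have hmeas : MeasurableSet {s : Fin n → E | (k : ℝ) / 2 ≤ count B s} :=
    measurableSet_le measurable_const (measurable_count hBm)
  have union : ∀ T : Set (Samples E n), {s | knn k s x ≠ bayes f g x} ⊆
      {s | count B s.1 + count B s.2 < k} ∪ T →
      (samplesLaw vol f g n).real T ≤ Real.exp (-(k * D ^ 2 / 32)) →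
      (samplesLaw vol f g n).real {s | knn k s x ≠ bayes f g x} ≤
        2 * Real.exp (-(k * D ^ 2 / 32)) := by
    have := isProbabilityMeasure_samplesLaw hf hg n
    intro T h1 h2
    linarith [(measureReal_mono (μ := samplesLaw vol f g n) h1).trans (measureReal_union_le _ _)]
  have hxp : 0 < f x + g x := by
    rw [add_eq_two_mul_mu]
    exact mul_pos two_pos hx
  rcases lt_or_ge (1 / 2) (eta f g x) with hlt | hge
  · have hDx : D = eta f g x - 1 / 2 := abs_of_pos (by linarith)
    have hbayes : bayes f g x = 0 := by
      rw [bayes, if_neg]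
      have := eta_mul_add hx
      rw [not_le]
      nlinarith
    refine union ((fun s => s.2) ⁻¹' {s | (k : ℝ) / 2 ≤ count B s}) ?_ ?_
    · intro s hs
      rw [mem_ofPred_eq, hbayes] at hs
      rw [mem_union, mem_ofPred_eq, mem_preimage, mem_ofPred_eq, or_iff_not_imp_left, not_lt]
      exact fun h => half_le_count_of_knn_eq_one hk s x ρ h (by omega)
    · rw [samplesLaw, measurePreserving_snd.measureReal_preimage hmeas.nullMeasurableSet]
      refine key g hg (fun z hz hzO => ?_) fun z hz => (eq_zero_of_notMem_Omega hf hg hz).2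
      have h1 := (abs_le.1 (hball z hz hzO)).1
      have h2 := eta_mul_add hzO
      nlinarith [hf.nonneg z, hg.nonneg z]
  · have hDx : D = 1 / 2 - eta f g x := by
      rw [hD, abs_of_nonpos (by linarith), neg_sub]
    have hbayes : bayes f g x = 1 := by
      rw [bayes, if_pos]
      have := eta_mul_add hx
      nlinarith
    refine union ((fun s => s.1) ⁻¹' {s | (k : ℝ) / 2 ≤ count B s}) ?_ ?_
    · intro s hs
      rw [mem_ofPred_eq, hbayes] at hs
      rw [mem_union, mem_ofPred_eq, mem_preimage, mem_ofPred_eq, or_iff_not_imp_left, not_lt]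
      exact fun h => half_le_count_of_knn_eq_zero hk hkn s x ρ h (by omega)
    · rw [samplesLaw, measurePreserving_fst.measureReal_preimage hmeas.nullMeasurableSet]
      refine key f hf (fun z hz hzO => ?_) fun z hz => (eq_zero_of_notMem_Omega hf hg hz).1
      have h1 := (abs_le.1 (hball z hz hzO)).2
      have h2 := eta_mul_add hzO
      nlinarith [hf.nonneg z, hg.nonneg z]

end

section

/-! ### The expected excess risk -/

section Excess

variable {E : Type*} [MeasurableSpace E] {vol : Measure E} {f g : E → ℝ}

open Classical in
theorem integrable_risk (hf : IsDensity vol f) (hg : IsDensity vol g) {Φ : E → Fin 2}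
    (hΦ : Measurable Φ) : Integrable (fun x => if Φ x = 1 then f x else g x) vol := by
  have h : MeasurableSet {x | Φ x = 1} := hΦ (measurableSet_singleton 1)
  refine (hf.integrable.add hg.integrable).mono
    (Measurable.ite h hf.measurable hg.measurable).aestronglyMeasurable (ae_of_all _ fun x => ?_)
  have h1 := hf.nonneg x
  have h2 := hg.nonneg x
  rw [Pi.add_apply, Real.norm_of_nonneg (add_nonneg h1 h2)]
  split_ifs <;> rw [Real.norm_of_nonneg] <;> linarith

open Classical in
theorem risk_eq_integral (hf : IsDensity vol f) (hg : IsDensity vol g) {Φ : E → Fin 2}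
    (hΦ : Measurable Φ) :
    risk vol f g Φ = (1 / 2) * ∫ x, if Φ x = 1 then f x else g x ∂vol := by
  have h : MeasurableSet {x | Φ x = 1} := hΦ (measurableSet_singleton 1)
  have hc : {x | Φ x = 1}ᶜ = {x | Φ x = 0} := by
    ext x
    rw [mem_compl_iff, mem_ofPred_eq, mem_ofPred_eq]
    omega
  rw [risk, ← integral_add_compl h (integrable_risk hf hg hΦ), ← hc]
  congr 2
  · exact setIntegral_congr_fun h fun x hx => (if_pos hx).symm
  · exact setIntegral_congr_fun h.compl fun x hx => (if_neg hx).symm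

open Classical in
theorem risk_sub_risk_bayes (hf : IsDensity vol f) (hg : IsDensity vol g) {Φ : E → Fin 2}
    (hΦ : Measurable Φ) (hb : Measurable (bayes f g)) :
    risk vol f g Φ - risk vol f g (bayes f g) =
      ∫ x, |f x - g x| / 2 * (if Φ x ≠ bayes f g x then 1 else 0) ∂vol := by
  rw [risk_eq_integral hf hg hΦ, risk_eq_integral hf hg hb, ← mul_sub,
    ← integral_sub (integrable_risk hf hg hΦ) (integrable_risk hf hg hb), ← integral_const_mul]
  congr 1 with x
  have hΦx : Φ x = 0 ∨ Φ x = 1 := by omega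
  by_cases hfg : f x ≤ g x
  · rw [abs_of_nonpos (sub_nonpos.2 hfg)]
    rcases hΦx with h | h
    · simp [bayes, hfg, h]
      ring
    · simp [bayes, hfg, h]
  · rw [abs_of_pos (sub_pos.2 (not_le.1 hfg))]
    rcases hΦx with h | h
    · simp [bayes, hfg, h]
    · simp [bayes, hfg, h]
      ring

theorem measurable_bayes (hf : IsDensity vol f) (hg : IsDensity vol g) :
    Measurable (bayes f g) := by
  classical
  exact Measurable.ite (measurableSet_le hf.measurable hg.measurable) measurable_const
    measurable_const

end Excess

variable {E : Type*} [NormedAddCommGroup E] [NormedSpace ℝ E] [FiniteDimensional ℝ E]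
  [MeasurableSpace E] [BorelSpace E] {vol : Measure E} [vol.IsAddHaarMeasure] {f g : E → ℝ}

theorem expectedExcessRiskLE_of_integral_le (hf : IsDensity vol f) (hg : IsDensity vol g)
    {n k : ℕ} {b : ℝ}
    (h : ∫ x, 2 * |eta f g x - 1 / 2| * mu f g x *
      (samplesLaw vol f g n).real {s | knn k s x ≠ bayes f g x} ∂vol ≤ b) :
    ExpectedExcessRiskLE vol f g n k b := by
  classical
  have : ProperSpace E := FiniteDimensional.proper ℝ E
  have := isProbabilityMeasure_samplesLaw hf hg n
  set P := samplesLaw vol f g n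
  let F : Samples E n × E → ℝ := fun p =>
    |f p.2 - g p.2| / 2 * (if knn k p.1 p.2 ≠ bayes f g p.2 then 1 else 0)
  have hknn : Measurable fun p : Samples E n × E => knn k p.1 p.2 := measurable_knn n k
  have hb := measurable_bayes hf hg
  have hset : MeasurableSet {p : Samples E n × E | knn k p.1 p.2 ≠ bayes f g p.2} :=
    (measurableSet_eq_fun hknn (hb.comp measurable_snd)).compl
  have hint : Integrable F (P.prod vol) := by
    have h1 : Integrable (fun p : Samples E n × E => |f p.2 - g p.2| / 2) (P.prod vol) :=
      ((hf.integrable.sub hg.integrable).abs.div_const 2).comp_snd P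
    refine h1.mono (h1.aestronglyMeasurable.mul
      (Measurable.ite hset measurable_const measurable_const).aestronglyMeasurable)
      (ae_of_all _ fun p => ?_)
    simp only [F, norm_mul]
    refine mul_le_of_le_one_right (norm_nonneg _) ?_
    split_ifs <;> simp
  have hexc : (fun s : Samples E n => excessRisk vol f g k s) =
      fun s => ∫ x, F (s, x) ∂vol := by
    funext s
    have hs : Measurable (knn k s) := by
      have := hknn.comp (measurable_prodMk_left (x := s))
      exact this
    exact risk_sub_risk_bayes hf hg hs hb
  rw [ExpectedExcessRiskLE, hexc]
  refine ⟨hint.integral_prod_left, ?_⟩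
  rw [integral_integral_swap (f := fun s x => F (s, x)) hint]
  refine le_trans (le_of_eq (integral_congr_ae (ae_of_all _ fun x => ?_))) h
  dsimp only [F]
  rw [integral_const_mul, abs_sub_div_two hf hg]
  congr 1
  have hx : MeasurableSet {s : Samples E n | knn k s x ≠ bayes f g x} :=
    measurable_prodMk_right hset
  rw [← integral_indicator_one hx]
  congr 1 with s
  by_cases hsx : knn k s x = bayes f g x <;> simp [hsx]

/-! ### Integration of the pointwise bound -/

theorem summable_rpow_mul_exp {c : ℝ} (hc : 0 < c) (β : ℝ) :
    Summable fun j : ℕ => ((j : ℝ) + 1) ^ β * Real.exp (-(c * (j : ℝ) ^ 2)) := by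
  obtain ⟨m, hm⟩ := exists_nat_ge β
  have h := ((summable_nat_add_iff 1).2 (Real.summable_pow_mul_exp_neg_nat_mul m hc)).mul_left
    (Real.exp c)
  refine Summable.of_nonneg_of_le (fun j => by positivity) (fun j => ?_) h
  have h1 : ((j : ℝ) + 1) ^ β ≤ ((j : ℝ) + 1) ^ m := by
    rw [← Real.rpow_natCast]
    exact Real.rpow_le_rpow_of_exponent_le (by linarith [j.cast_nonneg (α := ℝ)]) hm
  have h2 : (j : ℝ) ≤ (j : ℝ) ^ 2 := by exact_mod_cast Nat.le_self_pow two_ne_zero j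
  push_cast
  rw [mul_left_comm, ← Real.exp_add]
  refine mul_le_mul h1 (Real.exp_le_exp.2 ?_) (Real.exp_pos _).le (by positivity)
  -- From `j ≤ j^2`, `exp(-c * j^2) ≤ exp c * exp(-c * (j + 1))`.
  nlinarith

/-- Peeling: the single term `j = ⌊D/ν⌋` already dominates. The indicators are of `D < (j+1) * ν`
rather than of shells, since these are the sets the margin assumption measures. -/
theorem mul_exp_le_sum {c ν D : ℝ} (hc : 0 ≤ c) (hν : 0 < ν) (hD : 0 ≤ D) {N : ℕ}
    (hN : D < N * ν) :
    D * Real.exp (-(c * (D / ν) ^ 2)) ≤ ∑ j ∈ Finset.range N,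
      ν * (((j : ℝ) + 1) * Real.exp (-(c * (j : ℝ) ^ 2))) *
        (Iio (((j : ℝ) + 1) * ν)).indicator 1 D := by
  have h0 : 0 ≤ D / ν := div_nonneg hD hν.le
  have hj : ⌊D / ν⌋₊ ∈ Finset.range N := by
    rw [Finset.mem_range, Nat.floor_lt h0, div_lt_iff₀ hν]
    exact hN
  refine le_trans ?_ (Finset.single_le_sum (f := fun j : ℕ =>
    ν * (((j : ℝ) + 1) * Real.exp (-(c * (j : ℝ) ^ 2))) *
      (Iio (((j : ℝ) + 1) * ν)).indicator 1 D) (fun j _ => ?_) hj)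
  · have h1 : D < ((⌊D / ν⌋₊ : ℝ) + 1) * ν := (div_lt_iff₀ hν).1 (Nat.lt_floor_add_one _)
    have h2 := Nat.floor_le h0
    rw [indicator_of_mem (mem_Iio.2 h1), Pi.one_apply, mul_one, ← mul_assoc]
    refine mul_le_mul (by linarith) (Real.exp_le_exp.2 ?_) (Real.exp_pos _).le (by positivity)
    rw [neg_le_neg_iff]
    gcongr
  · exact mul_nonneg (by positivity) (indicator_nonneg (fun _ _ => zero_le_one) _)

theorem Margin.integral_mu_le {E : Type*} [MeasurableSpace E] {vol : Measure E} {f g : E → ℝ}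
    {α C : ℝ} (h : Margin vol f g α C) {ε : ℝ} (hε : 0 < ε) :
    ∫ x in {x | |eta f g x - 1 / 2| < ε}, mu f g x ∂vol ≤ C / 2 * ε ^ α := by
  have := h ε hε
  simp only [add_eq_two_mul_mu] at this
  rw [integral_const_mul] at this
  linarith

theorem integral_error_le_one {E : Type*} [MeasurableSpace E] {vol : Measure E} {f g : E → ℝ}
    (hf : IsDensity vol f) (hg : IsDensity vol g) {p : E → ℝ} (hp0 : ∀ x, 0 ≤ p x)
    (hp1 : ∀ x, p x ≤ 1) :
    ∫ x, 2 * |eta f g x - 1 / 2| * mu f g x * p x ∂vol ≤ 1 := by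
  refine le_trans ?_ (integral_mu hf hg).le
  refine integral_mono_of_nonneg (ae_of_all _ fun x => ?_) (integrable_mu hf hg)
    (ae_of_all _ fun x => ?_)
  · exact mul_nonneg (mul_nonneg (by positivity) (mu_nonneg hf hg x)) (hp0 x)
  · have h1 := abs_eta_sub_half_le hf hg x
    have h2 := mu_nonneg hf hg x
    refine (mul_le_of_le_one_right (mul_nonneg (by positivity) h2) (hp1 x)).trans ?_
    exact mul_le_of_le_one_left h2 (by linarith)

/-- The excess risk of a rule whose probability of error is exponentially small away from the
boundary `{η = 1 / 2}` and from the region where the density is small. -/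
theorem integral_error_le {E : Type*} [MeasurableSpace E] {vol : Measure E} {f g : E → ℝ}
    (hf : IsDensity vol f) (hg : IsDensity vol g) {α C M ν a c : ℝ}
    (hC : 0 ≤ C) (hM : 0 < M) (hν : 0 < ν) (hc : 0 < c)
    (hmargin : Margin vol f g α C)
    (htail : ∫ x in {x | mu f g x < a}, mu f g x ∂vol ≤ ν ^ (1 + α))
    {p : E → ℝ} (hp0 : ∀ x, 0 ≤ p x) (hp1 : ∀ x, p x ≤ 1)
    (hp : ∀ x ∈ Omega f g, a ≤ mu f g x → M * ν ≤ |eta f g x - 1 / 2| →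
      p x ≤ 2 * Real.exp (-(c * (|eta f g x - 1 / 2| / ν) ^ 2))) :
    ∫ x, 2 * |eta f g x - 1 / 2| * mu f g x * p x ∂vol ≤
      (1 + C * M ^ (1 + α) +
        2 * C * ∑' j : ℕ, ((j : ℝ) + 1) ^ (1 + α) * Real.exp (-(c * (j : ℝ) ^ 2))) *
        ν ^ (1 + α) := by
  set D : E → ℝ := fun x => |eta f g x - 1 / 2|
  have hDm : Measurable D := ((measurable_eta hf hg).sub_const _).abs
  have hmu := integrable_mu hf hg
  have hmum := measurable_mu hf hg
  -- Since `D ≤ 1/2`, finitely many levels suffice, which avoids exchanging a series with the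
  -- integral.
  obtain ⟨N, hN⟩ := exists_nat_gt (1 / (2 * ν))
  have hN' : 1 / 2 < N * ν := by
    rw [div_lt_iff₀ (by positivity)] at hN
    linarith
  have hset : ∀ ε : ℝ, MeasurableSet {x | D x < ε} := fun ε =>
    measurableSet_lt hDm measurable_const
  have hseta : MeasurableSet {x | mu f g x < a} := measurableSet_lt hmum measurable_const
  let w : ℕ → ℝ := fun j => ν * (((j : ℝ) + 1) * Real.exp (-(c * (j : ℝ) ^ 2)))
  let G : E → ℝ := fun x => {x | mu f g x < a}.indicator (mu f g) x +
    2 * (M * ν) * {x | D x < M * ν}.indicator (mu f g) x +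
    4 * ∑ j ∈ Finset.range N, w j * {x | D x < ((j : ℝ) + 1) * ν}.indicator (mu f g) x
  have hw : ∀ j, 0 ≤ w j := fun j => by positivity
  have hG1 : Integrable ({x | mu f g x < a}.indicator (mu f g)) vol := hmu.indicator hseta
  have hG2 : Integrable (fun x => 2 * (M * ν) * {x | D x < M * ν}.indicator (mu f g) x) vol :=
    (hmu.indicator (hset _)).const_mul _
  have hG3 : ∀ j ∈ Finset.range N, Integrable
      (fun x => w j * {x | D x < ((j : ℝ) + 1) * ν}.indicator (mu f g) x) vol := fun j _ =>
    (hmu.indicator (hset _)).const_mul _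
  have hG12 := hG1.add hG2
  have hG4 := (integrable_finsetSum _ hG3).const_mul 4
  have hind : ∀ (A : Set E) (x : E), 0 ≤ A.indicator (mu f g) x := fun A x =>
    indicator_nonneg (fun x _ => mu_nonneg hf hg x) x
  have hle : ∀ x, 2 * D x * mu f g x * p x ≤ G x := by
    intro x
    have hm := mu_nonneg hf hg x
    have hD0 : 0 ≤ D x := abs_nonneg _
    have hD1 : D x ≤ 1 / 2 := abs_eta_sub_half_le hf hg x
    have h1 := hind {x | mu f g x < a} x
    have h2 : 0 ≤ 2 * (M * ν) * {x | D x < M * ν}.indicator (mu f g) x :=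
      mul_nonneg (by positivity) (hind _ x)
    have h3 : 0 ≤ 4 * ∑ j ∈ Finset.range N,
        w j * {x | D x < ((j : ℝ) + 1) * ν}.indicator (mu f g) x :=
      mul_nonneg (by norm_num) (Finset.sum_nonneg fun j _ => mul_nonneg (hw j) (hind _ x))
    have hb : 2 * D x * mu f g x * p x ≤ 2 * D x * mu f g x :=
      mul_le_of_le_one_right (by positivity) (hp1 x)
    by_cases ha : mu f g x < a
    · have h4 : {x | mu f g x < a}.indicator (mu f g) x = mu f g x :=
        indicator_of_mem (by exact ha) _
      simp only [G]
      nlinarith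
    by_cases hDx : D x < M * ν
    · have h4 : {x | D x < M * ν}.indicator (mu f g) x = mu f g x :=
        indicator_of_mem (by exact hDx) _
      simp only [G]
      rw [h4] at h2 ⊢
      nlinarith
    by_cases hO : x ∈ Omega f g
    · have h4 := hp x hO (not_lt.1 ha) (not_lt.1 hDx)
      have h5 := mul_exp_le_sum hc.le hν hD0 (hD1.trans_lt hN')
      have h6 : 2 * D x * mu f g x * p x ≤
          4 * (mu f g x * (D x * Real.exp (-(c * (D x / ν) ^ 2)))) := by
        refine (mul_le_mul_of_nonneg_left h4 (by positivity)).trans_eq ?_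
        ring
      have h7 : mu f g x * (∑ j ∈ Finset.range N, w j *
          (Iio (((j : ℝ) + 1) * ν)).indicator 1 (D x)) =
          ∑ j ∈ Finset.range N, w j * {x | D x < ((j : ℝ) + 1) * ν}.indicator (mu f g) x := by
        rw [Finset.mul_sum]
        refine Finset.sum_congr rfl fun j _ => ?_
        by_cases hj : D x < ((j : ℝ) + 1) * ν
        · rw [indicator_of_mem (mem_Iio.2 hj), indicator_of_mem (by exact hj), Pi.one_apply]
          ring
        · rw [indicator_of_notMem (fun h => hj (mem_Iio.1 h)), indicator_of_notMem (by exact hj)]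
          ring
      have h8 := mul_le_mul_of_nonneg_left h5 hm
      rw [h7] at h8
      simp only [G]
      linarith
    · have h4 : mu f g x = 0 := le_antisymm (not_lt.1 hO) hm
      rw [h4, mul_zero, zero_mul]
      simp only [G]
      linarith
  have hmono := integral_mono_of_nonneg (μ := vol) (ae_of_all _ fun x =>
    mul_nonneg (mul_nonneg (mul_nonneg zero_le_two (abs_nonneg (eta f g x - 1 / 2)))
      (mu_nonneg hf hg x)) (hp0 x)) (hG12.add hG4) (ae_of_all _ hle)
  refine hmono.trans ?_
  have hGint : ∫ x, G x ∂vol = (∫ x in {x | mu f g x < a}, mu f g x ∂vol) +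
      2 * (M * ν) * (∫ x in {x | D x < M * ν}, mu f g x ∂vol) +
      4 * ∑ j ∈ Finset.range N,
        w j * ∫ x in {x | D x < ((j : ℝ) + 1) * ν}, mu f g x ∂vol := by
    refine (integral_add hG12 hG4).trans ?_
    rw [integral_add' hG1 hG2, integral_indicator hseta,
      integral_const_mul, integral_indicator (hset _), integral_const_mul,
      integral_finsetSum _ hG3]
    simp only [integral_const_mul, integral_indicator (hset _)]
  refine hGint.trans_le ?_
  have hν1 : ν ^ (1 + α) = ν * ν ^ α := by rw [Real.rpow_add hν, Real.rpow_one]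
  have hM1 : M ^ (1 + α) = M * M ^ α := by rw [Real.rpow_add hM, Real.rpow_one]
  have e2 : 2 * (M * ν) * (∫ x in {x | D x < M * ν}, mu f g x ∂vol) ≤
      C * M ^ (1 + α) * ν ^ (1 + α) := by
    refine (mul_le_mul_of_nonneg_left (hmargin.integral_mu_le (ε := M * ν) (by positivity))
      (by positivity)).trans_eq ?_
    rw [hν1, hM1, Real.mul_rpow hM.le hν.le]
    ring
  have e3 : ∀ j : ℕ, w j * (∫ x in {x | D x < ((j : ℝ) + 1) * ν}, mu f g x ∂vol) ≤
      C / 2 * ν ^ (1 + α) * (((j : ℝ) + 1) ^ (1 + α) * Real.exp (-(c * (j : ℝ) ^ 2))) := by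
    intro j
    have hj : (0 : ℝ) < (j : ℝ) + 1 := by positivity
    refine (mul_le_mul_of_nonneg_left (hmargin.integral_mu_le (ε := ((j : ℝ) + 1) * ν)
      (by positivity)) (hw j)).trans_eq ?_
    rw [hν1, Real.rpow_add hj, Real.rpow_one, Real.mul_rpow hj.le hν.le]
    simp only [w]
    ring
  have e4 : ∑ j ∈ Finset.range N, w j * (∫ x in {x | D x < ((j : ℝ) + 1) * ν}, mu f g x ∂vol) ≤
      C / 2 * ν ^ (1 + α) *
        ∑' j : ℕ, ((j : ℝ) + 1) ^ (1 + α) * Real.exp (-(c * (j : ℝ) ^ 2)) := by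
    refine (Finset.sum_le_sum fun j _ => e3 j).trans ?_
    rw [← Finset.mul_sum]
    exact mul_le_mul_of_nonneg_left ((summable_rpow_mul_exp hc _).sum_le_tsum _
      fun j _ => by positivity) (by positivity)
  linarith

end

section

/-! ### The generalized inverse and the balance equation -/

section Inverse

variable {ψ : ℝ → ℝ} {t₀ : ℝ}

theorem pos_of_strictMonoOn (hψ : StrictMonoOn ψ (Ioo 0 t₀)) (h0 : Tendsto ψ (𝓝[>] 0) (𝓝 0))
    {t : ℝ} (ht : t ∈ Ioo 0 t₀) : 0 < ψ t := by
  have hs : t / 2 ∈ Ioo 0 t₀ := ⟨by linarith [ht.1], by linarith [ht.1, ht.2]⟩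
  have h1 : 0 ≤ ψ (t / 2) := by
    refine le_of_tendsto h0 ?_
    filter_upwards [Ioo_mem_nhdsGT hs.1] with r hr
    exact (hψ ⟨hr.1, hr.2.trans hs.2⟩ hs hr.2).le
  exact h1.trans_lt (hψ hs ht (by linarith [ht.1]))

theorem bddAbove_inverse (ψ : ℝ → ℝ) (t₀ u : ℝ) : BddAbove {t | t ∈ Ioo 0 t₀ ∧ ψ t ≤ u} :=
  ⟨t₀, fun _ ht => ht.1.2.le⟩

theorem inverse_set_nonempty (ht₀ : 0 < t₀) (h0 : Tendsto ψ (𝓝[>] 0) (𝓝 0)) {u : ℝ}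
    (hu : 0 < u) : {t | t ∈ Ioo 0 t₀ ∧ ψ t ≤ u}.Nonempty := by
  obtain ⟨t, h1, h2⟩ := ((h0.eventually (gt_mem_nhds hu)).and (Ioo_mem_nhdsGT ht₀)).exists
  exact ⟨t, h2, h1.le⟩

theorem inverse_le (ht₀ : 0 < t₀) (h0 : Tendsto ψ (𝓝[>] 0) (𝓝 0)) {u : ℝ} (hu : 0 < u) :
    inverse ψ t₀ u ≤ t₀ :=
  csSup_le (inverse_set_nonempty ht₀ h0 hu) fun _ ht => ht.1.2.le

theorem inverse_pos (ht₀ : 0 < t₀) (h0 : Tendsto ψ (𝓝[>] 0) (𝓝 0)) {u : ℝ} (hu : 0 < u) :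
    0 < inverse ψ t₀ u := by
  obtain ⟨t, ht⟩ := inverse_set_nonempty ht₀ h0 hu
  exact ht.1.1.trans_le (le_csSup (bddAbove_inverse ψ t₀ u) ht)

theorem inverse_mono (ht₀ : 0 < t₀) (h0 : Tendsto ψ (𝓝[>] 0) (𝓝 0)) {u v : ℝ} (hu : 0 < u)
    (huv : u ≤ v) : inverse ψ t₀ u ≤ inverse ψ t₀ v :=
  csSup_le_csSup (bddAbove_inverse ψ t₀ v) (inverse_set_nonempty ht₀ h0 hu)
    fun _ ht => ⟨ht.1, ht.2.trans huv⟩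

theorem le_inverse {u t : ℝ} (ht : t ∈ Ioo 0 t₀) (h : ψ t ≤ u) : t ≤ inverse ψ t₀ u :=
  le_csSup (bddAbove_inverse ψ t₀ u) ⟨ht, h⟩

theorem apply_lt_of_lt_inverse (hψ : StrictMonoOn ψ (Ioo 0 t₀)) (ht₀ : 0 < t₀)
    (h0 : Tendsto ψ (𝓝[>] 0) (𝓝 0)) {u t : ℝ} (hu : 0 < u) (ht : 0 < t)
    (h : t < inverse ψ t₀ u) : t ∈ Ioo 0 t₀ ∧ ψ t < u := by
  obtain ⟨s, hs, hts⟩ := exists_lt_of_lt_csSup (inverse_set_nonempty ht₀ h0 hu) h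
  have ht' : t ∈ Ioo 0 t₀ := ⟨ht, hts.trans hs.1.2⟩
  exact ⟨ht', (hψ ht' hs.1 hts).trans_le hs.2⟩

theorem inverse_le_of_lt_apply (hψ : StrictMonoOn ψ (Ioo 0 t₀)) (ht₀ : 0 < t₀)
    (h0 : Tendsto ψ (𝓝[>] 0) (𝓝 0)) {u t : ℝ} (hu : 0 < u) (ht : t ∈ Ioo 0 t₀)
    (h : u < ψ t) : inverse ψ t₀ u ≤ t := by
  by_contra! hlt
  exact lt_asymm h (apply_lt_of_lt_inverse hψ ht₀ h0 hu ht.1 hlt).2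

/-- No continuity of `ψ` is needed: a jump of `ψ` is a flat piece of the inverse, and only a flat
piece of `ψ`, excluded by strict monotonicity, would create a jump. -/
theorem continuousAt_inverse (hψ : StrictMonoOn ψ (Ioo 0 t₀)) (ht₀ : 0 < t₀)
    (h0 : Tendsto ψ (𝓝[>] 0) (𝓝 0)) {u : ℝ} (hu : 0 < u) :
    ContinuousAt (inverse ψ t₀) u := by
  have hpos := inverse_pos ht₀ h0 hu
  refine tendsto_order.2 ⟨fun b hb => ?_, fun b hb => ?_⟩
  · obtain ⟨t, h1, h2⟩ := exists_between (max_lt hb hpos)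
    have ht := apply_lt_of_lt_inverse hψ ht₀ h0 hu ((le_max_right _ _).trans_lt h1) h2
    filter_upwards [lt_mem_nhds ht.2] with v hv
    exact ((le_max_left _ _).trans_lt h1).trans_le (le_inverse ht.1 hv.le)
  · rcases lt_or_ge t₀ b with h | h
    · filter_upwards [lt_mem_nhds hu] with v hv
      exact (inverse_le ht₀ h0 hv).trans_lt h
    · obtain ⟨t, h1, h2⟩ := exists_between hb
      obtain ⟨s, h3, h4⟩ := exists_between h1
      have ht : t ∈ Ioo 0 t₀ := ⟨hpos.trans h1, h2.trans_le h⟩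
      have hs : s ∈ Ioo 0 t₀ := ⟨hpos.trans h3, h4.trans ht.2⟩
      have hus : u ≤ ψ s := by
        by_contra! hlt
        exact h3.not_ge (le_inverse hs hlt.le)
      filter_upwards [lt_mem_nhds hu, gt_mem_nhds (hus.trans_lt (hψ hs ht h4))] with v hv hv'
      exact (inverse_le_of_lt_apply hψ ht₀ h0 hv ht hv').trans_lt h2

theorem eventually_inverse_lt (hψ : StrictMonoOn ψ (Ioo 0 t₀)) (ht₀ : 0 < t₀)
    (h0 : Tendsto ψ (𝓝[>] 0) (𝓝 0)) {ε : ℝ} (hε : 0 < ε) :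
    ∃ u₀ > 0, ∀ u, 0 < u → u < u₀ → inverse ψ t₀ u < ε := by
  have ht : min ε t₀ / 2 ∈ Ioo 0 t₀ :=
    ⟨by positivity, by linarith [min_le_right ε t₀, lt_min hε ht₀]⟩
  refine ⟨ψ (min ε t₀ / 2), pos_of_strictMonoOn hψ h0 ht, fun u hu hlt => ?_⟩
  linarith [inverse_le_of_lt_apply hψ ht₀ h0 hu ht hlt, min_le_left ε t₀, lt_min hε ht₀]

/-- The balance equation has exactly one solution. -/
theorem existsUnique_balance (hψ : StrictMonoOn ψ (Ioo 0 t₀)) (ht₀ : 0 < t₀)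
    (h0 : Tendsto ψ (𝓝[>] 0) (𝓝 0)) {α : ℝ} (hα : 0 < α) (d : ℕ) {n : ℕ} (hn : 2 ≤ n) :
    ∃! ν : ℝ, Balance ψ t₀ α d n ν := by
  have hn' : (1 : ℝ) < n := by exact_mod_cast hn
  have hy : 0 < Real.log n / n := div_pos (Real.log_pos hn') (by linarith)
  set y := Real.log n / n
  let h : ℝ → ℝ := fun ν => inverse ψ t₀ (ν ^ (1 + α)) * ν ^ (2 + d)
  have hα1 : 0 < 1 + α := by linarith
  -- The inverse factor may be constant; strictness comes from the power `ν ^ (2 + d)`.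
  have hmono : ∀ ν ν' : ℝ, 0 < ν → ν < ν' → h ν < h ν' := by
    intro ν ν' hν hlt
    refine mul_lt_mul' (inverse_mono ht₀ h0 (Real.rpow_pos_of_pos hν _)
      (Real.rpow_le_rpow hν.le hlt.le hα1.le)) (pow_lt_pow_left₀ hlt hν.le (by omega))
      (by positivity) (inverse_pos ht₀ h0 (Real.rpow_pos_of_pos (hν.trans hlt) _))
  have hpow : ∀ ν : ℝ, 0 < ν → ν ≤ 1 → ν ^ (2 + d) ≤ ν := fun ν hν hν1 =>
    pow_le_of_le_one hν.le hν1 (by omega)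
  have hpow' : ∀ ν : ℝ, 1 ≤ ν → ν ≤ ν ^ (2 + d) := fun ν hν => le_self_pow₀ hν (by omega)
  -- Left endpoint for the intermediate value theorem, using `inverse ≤ t₀` and `ν ^ (2 + d) ≤ ν`;
  -- the right endpoint `ν₂` below uses the reverse power inequality and the value of the inverse at
  -- `1`.
  set ν₁ := min 1 (y / t₀)
  have hν₁ : 0 < ν₁ := lt_min one_pos (div_pos hy ht₀)
  have h1 : h ν₁ ≤ y := by
    have e1 := inverse_le ht₀ h0 (Real.rpow_pos_of_pos hν₁ (1 + α))
    have e2 := (hpow ν₁ hν₁ (min_le_left _ _)).trans (min_le_right _ _)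
    calc h ν₁ ≤ t₀ * (y / t₀) := mul_le_mul e1 e2 (by positivity) ht₀.le
      _ = y := mul_div_cancel₀ _ ht₀.ne'
  have hb : 0 < inverse ψ t₀ 1 := inverse_pos ht₀ h0 one_pos
  set ν₂ := max 1 (y / inverse ψ t₀ 1)
  have hν₂ : 1 ≤ ν₂ := le_max_left _ _
  have h2 : y ≤ h ν₂ := by
    have e1 := inverse_mono ht₀ h0 one_pos (Real.one_le_rpow hν₂ hα1.le)
    have e2 := (le_max_right _ _).trans (hpow' ν₂ hν₂)
    calc y = inverse ψ t₀ 1 * (y / inverse ψ t₀ 1) := (mul_div_cancel₀ _ hb.ne').symm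
      _ ≤ h ν₂ := mul_le_mul e1 e2 (by positivity) (hb.le.trans e1)
  have hcont : ContinuousOn h (Icc ν₁ ν₂) := by
    intro ν hν
    have hpos : 0 < ν := hν₁.trans_le hν.1
    refine ContinuousAt.continuousWithinAt (ContinuousAt.mul ?_ (by fun_prop))
    exact ContinuousAt.comp (g := inverse ψ t₀) (f := fun ν : ℝ => ν ^ (1 + α))
      (continuousAt_inverse hψ ht₀ h0 (Real.rpow_pos_of_pos hpos _))
      (Real.continuousAt_rpow_const _ _ (Or.inl hpos.ne'))
  obtain ⟨ν, hν, hνy⟩ := intermediate_value_Icc ((min_le_left _ _).trans hν₂) hcont ⟨h1, h2⟩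
  refine ⟨ν, ⟨hν₁.trans_le hν.1, hνy.symm⟩, fun ν' hν' => ?_⟩
  have hνν' : h ν' = h ν := hν'.2.symm.trans hνy.symm
  rcases lt_trichotomy ν' ν with hlt | heq | hlt
  · exact absurd hνν' (hmono _ _ hν'.1 hlt).ne
  · exact heq
  · exact absurd hνν' (hmono _ _ (hν₁.trans_le hν.1) hlt).ne'

/-- For `ψ = id` the solution of the balance equation is explicit. -/
theorem balance_id {α : ℝ} (hα : 0 < α) (d : ℕ) {n : ℕ} (hn : 2 ≤ n) :
    Balance id 1 α d n ((Real.log n / n) ^ (1 / (3 + α + d))) := by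
  have hn' : (1 : ℝ) < n := by exact_mod_cast hn
  have hy : 0 < Real.log n / n := div_pos (Real.log_pos hn') (by linarith)
  have hy1 : Real.log n / n < 1 := by
    rw [div_lt_one (by linarith)]
    linarith [Real.log_le_sub_one_of_pos (show (0 : ℝ) < n by linarith)]
  have hd : 0 < 3 + α + d := by positivity
  have hν : 0 < (Real.log n / n) ^ (1 / (3 + α + d)) := Real.rpow_pos_of_pos hy _
  have hν1 : (Real.log n / n) ^ (1 / (3 + α + d)) < 1 := Real.rpow_lt_one hy.le hy1 (by positivity)
  refine ⟨hν, ?_⟩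
  have hinv := inverse_apply (ψ := id) (t₀ := 1) strictMonoOn_id
    ⟨Real.rpow_pos_of_pos hν (1 + α), Real.rpow_lt_one hν.le hν1 (by linarith)⟩
  rw [id] at hinv
  rw [hinv, ← Real.rpow_natCast, ← Real.rpow_add hν, ← Real.rpow_mul hy.le]
  push_cast
  rw [show 1 / (3 + α + d) * (1 + α + (2 + d)) = 1 by field_simp; ring, Real.rpow_one]

end Inverse

end

section

/-! ### The rate of convergence -/

variable {E : Type*} [NormedAddCommGroup E] [NormedSpace ℝ E] [FiniteDimensional ℝ E]
  [MeasurableSpace E] [BorelSpace E] {vol : Measure E} [vol.IsAddHaarMeasure]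

theorem exists_expectedExcessRiskLE [Nontrivial E] {α : ℝ} (hα : 0 < α) {ψ : ℝ → ℝ} {t₀ : ℝ}
    (ht₀ : 0 < t₀) (hψ : StrictMonoOn ψ (Ioo 0 t₀)) (h0 : Tendsto ψ (𝓝[>] 0) (𝓝 0))
    {L C κ δ₀ ε₀ c₁ c₂ : ℝ} (hL : 0 < L) (hC : 0 < C) (hκ : 0 < κ) (hδ₀ : 0 < δ₀) (hε₀ : 0 < ε₀)
    (hc₁ : 0 < c₁) :
    ∃ A : ℝ, 0 < A ∧ ∀ f g : E → ℝ, Admissible vol α L C κ δ₀ ψ ε₀ f g →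
      ∀ n k : ℕ, 2 ≤ n → ∀ ν : ℝ, Balance ψ t₀ α (Module.finrank ℝ E) n ν →
        NumNeighbours c₁ c₂ n ν k → ExpectedExcessRiskLE vol f g n k (A * ν ^ (1 + α)) := by
  obtain ⟨u₀, hu₀, hinv⟩ := eventually_inverse_lt hψ ht₀ h0 hε₀
  -- Balls of radius `Q * ν` will be used; `Q` is large enough for them to hold expected mass `2 *
  -- k`.
  set Q := max 1 (2 * c₂ / κ)
  have hQ1 : 1 ≤ Q := le_max_left _ _
  have hQ2 : 2 * c₂ ≤ κ * Q := (div_le_iff₀' hκ).1 (le_max_right _ _)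
  have hQ0 : 0 < Q := one_pos.trans_le hQ1
  have hα1 : 0 < 1 + α := by linarith
  -- Below `ν₀`, the radius `Q * ν` is at most `δ₀` and the density level is below `ε₀`, so the
  -- minimal mass and tail assumptions apply.
  set ν₀ := min (δ₀ / Q) (u₀ ^ (1 + α)⁻¹)
  have hν₀pos : 0 < ν₀ := lt_min (by positivity) (by positivity)
  have hd : Module.finrank ℝ E ≠ 0 := Module.finrank_pos.ne'
  set d := Module.finrank ℝ E
  set K := 1 + C * (2 * L * Q) ^ (1 + α) +
    2 * C * ∑' j : ℕ, ((j : ℝ) + 1) ^ (1 + α) * Real.exp (-(c₁ / 32 * (j : ℝ) ^ 2))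
  have hKpos : 0 < K := by
    have : 0 ≤ ∑' j : ℕ, ((j : ℝ) + 1) ^ (1 + α) * Real.exp (-(c₁ / 32 * (j : ℝ) ^ 2)) :=
      tsum_nonneg fun j => by positivity
    positivity
  refine ⟨K + (ν₀ ^ (1 + α))⁻¹, by positivity, ?_⟩
  intro f g hfg n k hn ν hbal hnum
  obtain ⟨hν, hbal⟩ := hbal
  obtain ⟨hkn, hk1, hk2⟩ := hnum
  have hf := hfg.density_f
  have hg := hfg.density_g
  have := isProbabilityMeasure_samplesLaw hf hg n
  have hνα : 0 < ν ^ (1 + α) := Real.rpow_pos_of_pos hν _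
  have hk : 0 < k := by
    rcases Nat.eq_zero_or_pos k with rfl | h
    · simp at hk1
      linarith
    · exact h
  have hk0 : (0 : ℝ) < k := by exact_mod_cast hk
  apply expectedExcessRiskLE_of_integral_le hf hg
  -- For `ν ≥ ν₀` the trivial bound `1` is absorbed by the constant, so the behaviour of `ν` in `n`
  -- is never studied.
  rcases le_or_gt ν₀ ν with hle | hlt
  · refine (integral_error_le_one hf hg (fun _ => measureReal_nonneg)
      fun _ => measureReal_le_one).trans ?_
    have h1 : ν₀ ^ (1 + α) ≤ ν ^ (1 + α) := Real.rpow_le_rpow hν₀pos.le hle hα1.le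
    have h2 : 1 ≤ (ν₀ ^ (1 + α))⁻¹ * ν ^ (1 + α) := by
      rw [inv_mul_eq_div, one_le_div (by positivity)]
      exact h1
    nlinarith
  · have hνδ : Q * ν ≤ δ₀ := by
      have := (lt_div_iff₀ hQ0).1 (hlt.trans_le (min_le_left _ _))
      linarith
    have hνu : ν ^ (1 + α) < u₀ := by
      have := Real.rpow_lt_rpow hν.le (hlt.trans_le (min_le_right _ _)) hα1
      rwa [Real.rpow_inv_rpow hu₀.le hα1.ne'] at this
    set a := inverse ψ t₀ (ν ^ (1 + α))
    have ha0 : 0 < a := inverse_pos ht₀ h0 hνα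
    have haε : a < ε₀ := hinv _ hνα hνu
    -- The supremum `a` need not satisfy `ψ a ≤ ν ^ (1 + α)`, but any level strictly below it does;
    -- `a / 2` costs only a constant.
    have htail : ∫ x in {x | mu f g x < a / 2}, mu f g x ∂vol ≤ ν ^ (1 + α) :=
      (hfg.tail (a / 2) (by linarith) (by linarith)).trans
        (apply_lt_of_lt_inverse hψ ht₀ h0 hνα (t := a / 2) (by linarith) (by linarith)).2.le
    refine (integral_error_le (M := 2 * L * Q) (c := c₁ / 32) hf hg hC.le (by positivity) hν
      (by positivity) hfg.margin htail (fun _ => measureReal_nonneg)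
      (fun _ => measureReal_le_one) fun x hx hax hDx => ?_).trans ?_
    · have hn0 : (0 : ℝ) < n := by
        have : 0 < n := by omega
        exact_mod_cast this
      have hD1 := abs_eta_sub_half_le hf hg x
      have hmass : (k : ℝ) * (1 + |eta f g x - 1 / 2| / 2) ≤
          2 * n * ∫ z in Metric.ball x (Q * ν), mu f g z ∂vol := by
        have h1 := hfg.minimalMass (Q * ν) (by positivity) hνδ x hx
        have h2 : κ * (a / 2) * (Q * ν ^ d) ≤ κ * mu f g x * (Q * ν) ^ d := by
          rw [mul_pow]
          have := le_self_pow₀ hQ1 hd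
          have := mu_nonneg hf hg x
          gcongr
        have h3 : Real.log n = n * (a * ν ^ (2 + d)) := by
          rw [← hbal]
          field_simp
        have h4 : 2 * k * ν ^ 2 ≤ n * (κ * a * (Q * ν ^ d)) * ν ^ 2 := by
          have hlog : 0 ≤ Real.log n := Real.log_natCast_nonneg n
          calc 2 * k * ν ^ 2 ≤ 2 * c₂ * Real.log n := by linarith
            _ ≤ κ * Q * Real.log n := mul_le_mul_of_nonneg_right hQ2 hlog
            _ = n * (κ * a * (Q * ν ^ d)) * ν ^ 2 := by
              rw [h3, pow_add]
              ring
        have h5 := le_of_mul_le_mul_right h4 (by positivity)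
        have h6 := mul_le_mul_of_nonneg_left (h2.trans h1) (by positivity : (0 : ℝ) ≤ 2 * n)
        -- `D ≤ 1/2` gives `k * (1 + D/2) ≤ 2 * k`.
        nlinarith
      refine (measure_knn_ne_bayes_le hf hg hL.le hfg.smoothness hk hkn hx (r := Q * ν)
        (by positivity) (by linarith) hmass).trans ?_
      gcongr
      rw [div_pow, le_div_iff₀ (by norm_num)]
      have h7 : c₁ / ν ^ 2 ≤ k := by
        rw [div_le_iff₀ (by positivity)]
        exact hk1
      have h8 := mul_le_mul_of_nonneg_right h7 (sq_nonneg |eta f g x - 1 / 2|)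
      refine le_trans (le_of_eq ?_) h8
      ring
    · refine mul_le_mul_of_nonneg_right ?_ hνα.le
      have : 0 < (ν₀ ^ (1 + α))⁻¹ := by positivity
      linarith

end

end SDA

end

/-! ### The explicit rate for the identity and the rate for general `ψ`. -/

theorem mainTheorem8 {E : Type*} [NormedAddCommGroup E] [NormedSpace ℝ E]
    [FiniteDimensional ℝ E] [MeasurableSpace E] [BorelSpace E]
    (vol : Measure E) [vol.IsAddHaarMeasure]
    (d : ℕ) (hd : 1 ≤ d) (hE : Module.finrank ℝ E = d) (α : ℝ) (hα : 0 < α) :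
    (∀ L C κ δ₀ ε₀ c₁ c₂ : ℝ, 0 < L → 0 < C → 0 < κ → 0 < δ₀ → 0 < ε₀ → 0 < c₁ → 0 < c₂ →
      ∃ A : ℝ, 0 < A ∧ ∀ f g : E → ℝ, SDA.Admissible vol α L C κ δ₀ id ε₀ f g →
        ∀ n k : ℕ, 2 ≤ n →
          SDA.NumNeighbours c₁ c₂ n ((Real.log n / n) ^ (1 / (3 + α + d))) k →
          SDA.ExpectedExcessRiskLE vol f g n k
            (A * (Real.log n / n) ^ ((1 + α) / (3 + α + d)))) ∧
    (∀ (ψ : ℝ → ℝ) (t₀ : ℝ), 0 < t₀ → StrictMonoOn ψ (Ioo 0 t₀) →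
      Tendsto ψ (𝓝[>] 0) (𝓝 0) →
      (∀ n : ℕ, 2 ≤ n → ∃! ν : ℝ, SDA.Balance ψ t₀ α d n ν) ∧
      ∀ L C κ δ₀ ε₀ c₁ c₂ : ℝ, 0 < L → 0 < C → 0 < κ → 0 < δ₀ → 0 < ε₀ → 0 < c₁ → 0 < c₂ →
        ∃ A : ℝ, 0 < A ∧ ∀ f g : E → ℝ, SDA.Admissible vol α L C κ δ₀ ψ ε₀ f g →
          ∀ n k : ℕ, 2 ≤ n → ∀ ν : ℝ, SDA.Balance ψ t₀ α d n ν →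
            SDA.NumNeighbours c₁ c₂ n ν k →
            SDA.ExpectedExcessRiskLE vol f g n k (A * ν ^ (1 + α))) := by
  subst hE
  have : Nontrivial E := Module.nontrivial_of_finrank_pos (R := ℝ) (by omega)
  refine ⟨?_, fun ψ t₀ ht₀ hψ h0 =>
    ⟨fun n hn => SDA.existsUnique_balance hψ ht₀ h0 hα _ hn, ?_⟩⟩
  · intro L C κ δ₀ ε₀ c₁ c₂ hL hC hκ hδ₀ hε₀ hc₁ _
    -- The cutoff `t₀ = 1` suffices for the identity, because `log n / n < 1` keeps `ν`, hence `ν ^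
    -- (1 + α)`, below `1`.
    obtain ⟨A, hA, h⟩ := SDA.exists_expectedExcessRiskLE (vol := vol) hα (ψ := id) one_pos
      strictMonoOn_id (tendsto_id.mono_left nhdsWithin_le_nhds) hL hC hκ hδ₀ hε₀ hc₁ (c₂ := c₂)
    refine ⟨A, hA, fun f g hfg n k hn hk => ?_⟩
    have h1 := h f g hfg n k hn _ (SDA.balance_id hα _ hn) hk
    rwa [← Real.rpow_mul (div_nonneg (Real.log_natCast_nonneg n) n.cast_nonneg),
      one_div_mul_eq_div] at h1
  · intro L C κ δ₀ ε₀ c₁ c₂ hL hC hκ hδ₀ hε₀ hc₁ _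
    exact SDA.exists_expectedExcessRiskLE hα ht₀ hψ h0 hL hC hκ hδ₀ hε₀ hc₁
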